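/- Let $k$ be an infinite field and $S=k[x,y,z]$. For a finite set $\mathcal{A}$ of points in $\mathbf{P}^2$ over $k$ (one-dimensional subspaces of $k^3$), let $I_{\mathcal{A}}\subseteq S$ be the intersection, over the points $p\in\mathcal{A}$, of the ideals of the corresponding lines through the origin in $k^3$, i.e. the ideal of all polynomials that vanish on the union of these lines. The set $\mathcal{A}$ is called generic if $\dim_k (S/I_{\mathcal{A}})_t=\min\{|\mathcal{A}|,\binom{t+2}{2}\}$ for all $t\ge 0$, and linearly general if no three distinct points of $\mathcal{A}$ are collinear. An ideal of $S$ is pl-generated if it is generated by products of linear forms. Let $\mathcal{A}$ be a set of $6$ points in $\mathbf{P}^2$ that is generic and linearly general. Then for every labelling $p_1,\dots,p_6$ of the points of $\mathcal{A}$, if $L_{i,j}$ $(i<j)$ denotes a linear form defining the line joining $p_i$ to $p_j$, the ideal $I_{\mathcal{A}}$ is generated by the four cubics \[Q_1=L_{1,2}L_{3,4}L_{5,6},\quad Q_2=L_{1,2}L_{3,5}L_{4,6},\quad Q_3=L_{1,5}L_{2,6}L_{3,4},\quad Q_4=L_{1,3}L_{2,6}L_{4,5}.\] In particular, $I_{\mathcal{A}}$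 is pl-generated. -/

import Mathlib

open scoped LinearAlgebra.Projectivization

noncomputable section

namespace PlanePoints

variable {k : Type*} [Field k]

/-- The projective plane over `k`: the lines through the origin in `k ^ 3`. -/
abbrev Plane (k : Type*) [Field k] : Type _ := ℙ k (Fin 3 → k)

/-- The polynomial ring `S = k[x, y, z]`. -/
abbrev PolyRing (k : Type*) [Field k] : Type _ := MvPolynomial (Fin 3) k

/-- The ideal of a finite set of points in the plane: the intersection, over the points `p`, of the
ideal of the polynomials that vanish on the one-dimensional subspace `p` of `k ^ 3`. -/
def pointsIdeal (A : Finset (Plane k)) : Ideal (PolyRing k) :=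
  ⨅ p ∈ A, MvPolynomial.vanishingIdeal k (p.submodule : Set (Fin 3 → k))

/-- The degree `t` part of `S / I`: the image of the forms of degree `t`. -/
def quotientDegree (I : Ideal (PolyRing k)) (t : ℕ) : Submodule k (PolyRing k ⧸ I) :=
  (MvPolynomial.homogeneousSubmodule (Fin 3) k t).map (Ideal.Quotient.mkₐ k I).toLinearMap

/-- `A` is generic: `dim_k (S / I_A)_t = min {#A, (t + 2) choose 2}` for every `t`. -/
def IsGeneric (A : Finset (Plane k)) : Prop :=
  ∀ t : ℕ, Module.finrank k (quotientDegree (pointsIdeal A) t) = min A.card ((t + 2).choose 2)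

/-- `A` is linearly general: no three distinct points of `A` are collinear. -/
def IsLinearlyGeneral (A : Finset (Plane k)) : Prop :=
  ∀ p ∈ A, ∀ q ∈ A, ∀ r ∈ A, p ≠ q → p ≠ r → q ≠ r →
    ¬ Projectivization.IsCollinear {p, q, r}

/-- `f` is a product of finitely many linear forms. -/
def IsProductOfLinearForms (f : PolyRing k) : Prop :=
  ∃ s : Multiset (PolyRing k), (∀ l ∈ s, l.IsHomogeneous 1) ∧ s.prod = f

/-- `I` is pl-generated: it is generated by products of linear forms. -/
def IsPLGenerated (I : Ideal (PolyRing k)) : Prop :=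
  ∃ G : Set (PolyRing k), (∀ f ∈ G, IsProductOfLinearForms f) ∧ I = Ideal.span G

/-- `l` is a nonzero linear form that vanishes at `p` and `q`; for `p ≠ q` this says that `l` is an
equation of the line joining `p` to `q`. -/
def IsLineEquation (l : PolyRing k) (p q : Plane k) : Prop :=
  l ≠ 0 ∧ l.IsHomogeneous 1 ∧
    (∀ v ∈ p.submodule, MvPolynomial.eval v l = 0) ∧
    ∀ v ∈ q.submodule, MvPolynomial.eval v l = 0

end PlanePoints

end

/-!
Choose a linear form `ℓ` that vanishes at none of the six points, so that `ℓ` is a nonzerodivisor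
modulo `I`. No conic contains the points, hence the `k`-span of the four cubics meets `ℓ S₂` only
in `0`. Once the cubics are known to be linearly independent, `10 = 4 + 6` shows that `S₃` is the
sum of their span and `ℓ S₂`. Multiplying by forms of degree `n - 2` gives
`Sₙ₊₁ = (Q₁, …, Q₄)ₙ₊₁ + ℓ Sₙ` for `n ≥ 2`; since `ℓ h ∈ I` forces `h ∈ I`, induction on the degree
reduces every form in `I` to the cubics.

The cubics are linearly independent because they have dual evaluation points: counting points from
`0`, the four intersections `L₁₅ ∩ L₂₄`, `L₁₅ ∩ L₂₃`, `L₀₁ ∩ L₃₄`, `L₀₁ ∩ L₂₃` lie off `Q₁`, `Q₂`,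
`Q₃`, `Q₄` respectively, and each lies on the other three cubics. Indeed the meeting point of two
joining lines without a common endpoint lies on no third line through one of the four endpoints.
-/

open MvPolynomial Module

open scoped Pointwise

namespace PlanePoints

section Forms

variable {σ R : Type*}

theorem eval_smul_of_isHomogeneous [CommSemiring R] {f : MvPolynomial σ R} {n : ℕ}
    (hf : f.IsHomogeneous n) (c : R) (v : σ → R) : eval (c • v) f = c ^ n * eval v f := by
  rw [eval_eq, eval_eq, Finset.mul_sum]
  refine Finset.sum_congr rfl fun d hd => ?_
  have hdeg : ∑ i ∈ d.support, d i = n := (hf.degree_eq_sum_deg_support hd).symm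
  simp only [Pi.smul_apply, smul_eq_mul, mul_pow, Finset.prod_mul_distrib,
    Finset.prod_pow_eq_pow_sum, hdeg]
  ring

theorem homogeneousSubmodule_mul_eq [CommSemiring R] (m n : ℕ) :
    homogeneousSubmodule σ R m * homogeneousSubmodule σ R n = homogeneousSubmodule σ R (m + n) := by
  simp only [← homogeneousSubmodule_one_pow (σ := σ) (R := R) (n := m),
    ← homogeneousSubmodule_one_pow (σ := σ) (R := R) (n := n),
    ← homogeneousSubmodule_one_pow (σ := σ) (R := R) (n := m + n), pow_add]

theorem finrank_homogeneousSubmodule [CommRing R] [Nontrivial R] [Fintype σ] (n : ℕ) :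
    finrank R (homogeneousSubmodule σ R n) = (Fintype.card σ).multichoose n := by
  classical
  have hdeg : {d : σ →₀ ℕ | d.degree = n} =
      ((Finset.univ : Finset σ).finsuppAntidiag n : Set (σ →₀ ℕ)) := by
    ext d
    simp [Finsupp.degree_eq_sum]
  rw [homogeneousSubmodule_eq_finsupp_supported, hdeg]
  refine (finrank_eq_card_basis (basisRestrictSupport R _)).trans ?_
  rw [← Set.toFinset_card, Finset.toFinset_coe, Finset.card_finsuppAntidiag_nat_eq_multichoose,
    Finset.card_univ]

theorem finrank_homogeneousSubmodule_fin_three [CommRing R] [Nontrivial R] (n : ℕ) :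
    finrank R (homogeneousSubmodule (Fin 3) R n) = (n + 2).choose 2 := by
  rw [finrank_homogeneousSubmodule, Fintype.card_fin, Nat.multichoose_eq,
    show 3 + n - 1 = n + 2 by omega, ← Nat.choose_symm_add]

/-- The homogeneous polynomial of degree one with the same values as the functional `φ`. -/
noncomputable def linearForm [CommSemiring R] [Fintype σ] [DecidableEq σ] (φ : Dual R (σ → R)) :
    MvPolynomial σ R :=
  ∑ i, φ (Pi.single i 1) • X i

theorem linearForm_isHomogeneous [CommSemiring R] [Fintype σ] [DecidableEq σ]
    (φ : Dual R (σ → R)) : (linearForm φ).IsHomogeneous 1 :=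
  (homogeneousSubmodule σ R 1).sum_mem fun i _ =>
    (homogeneousSubmodule σ R 1).smul_mem _ (isHomogeneous_X R i)

theorem eval_linearForm [CommSemiring R] [Fintype σ] [DecidableEq σ] (φ : Dual R (σ → R))
    (v : σ → R) : eval v (linearForm φ) = φ v := by
  rw [linearForm, map_sum, LinearMap.pi_apply_eq_sum_univ φ v]
  refine Finset.sum_congr rfl fun i _ => ?_
  rw [smul_eval, eval_X, mul_comm, smul_eq_mul]
  congr 2
  funext j
  simp [Pi.single_apply, eq_comm]

theorem exists_linearForm_eq [CommSemiring R] [Fintype σ] [DecidableEq σ] {l : MvPolynomial σ R}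
    (hl : l.IsHomogeneous 1) : ∃ φ : Dual R (σ → R), linearForm φ = l := by
  rw [← mem_homogeneousSubmodule, homogeneousSubmodule_one_eq_span_X,
    Submodule.mem_span_range_iff_exists_fun] at hl
  obtain ⟨c, rfl⟩ := hl
  refine ⟨Fintype.linearCombination R c, ?_⟩
  simp [linearForm]

theorem eval_homogeneousComponent_eq_zero [CommRing R] [IsDomain R] [Infinite R]
    {f : MvPolynomial σ R} {v : σ → R} (hf : ∀ c : R, eval (c • v) f = 0) (n : ℕ) :
    eval v (homogeneousComponent n f) = 0 := by
  let P : Polynomial R := ∑ i ∈ Finset.range (f.totalDegree + 1),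
    Polynomial.monomial i (eval v (homogeneousComponent i f))
  have hP : P = 0 := Polynomial.funext fun c => calc
    P.eval c = ∑ i ∈ Finset.range (f.totalDegree + 1),
        eval (c • v) (homogeneousComponent i f) := by
      simp only [P, Polynomial.eval_finsetSum, Polynomial.eval_monomial, mul_comm,
        eval_smul_of_isHomogeneous (homogeneousComponent_isHomogeneous _ f)]
    _ = Polynomial.eval c 0 := by
      rw [← map_sum, sum_homogeneousComponent, hf, Polynomial.eval_zero]
  by_cases hn : n ≤ f.totalDegree
  · simpa [P, Polynomial.finsetSum_coeff, Polynomial.coeff_monomial, Nat.lt_succ_iff, hn]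
      using congrArg (Polynomial.coeff · n) hP
  · rw [homogeneousComponent_eq_zero _ _ (not_le.mp hn), map_zero]

theorem linearIndependent_of_eval [CommRing R] [IsDomain R] {ι : Type*}
    {f : ι → MvPolynomial σ R} (x : ι → σ → R) (hdiag : ∀ i, eval (x i) (f i) ≠ 0)
    (hoff : ∀ i j, i ≠ j → eval (x i) (f j) = 0) : LinearIndependent R f := by
  rw [linearIndependent_iff']
  intro t g hg i hi
  have heval := congrArg (eval (x i)) hg
  simp only [map_sum, smul_eval, map_zero] at heval
  rw [Finset.sum_eq_single_of_mem i hi fun j _ hj => by rw [hoff i j hj.symm, mul_zero]] at heval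
  exact (mul_eq_zero.mp heval).resolve_right (hdiag i)

end Forms

section HomogeneousIdeal

attribute [local instance] MvPolynomial.gradedAlgebra

variable {σ k : Type*} [Field k]

theorem isHomogeneous_vanishingIdeal [Infinite k] {V : Set (σ → k)}
    (hV : ∀ c : k, ∀ v ∈ V, c • v ∈ V) :
    (vanishingIdeal k V).IsHomogeneous (homogeneousSubmodule σ k) := by
  intro n f hf
  rw [show (DirectSum.decompose (homogeneousSubmodule σ k) f n : MvPolynomial σ k) =
    homogeneousComponent n f from decomposition.decompose'_apply f n]
  exact fun v hv => eval_homogeneousComponent_eq_zero (fun c => hf _ (hV c v hv)) n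

theorem homogeneousSubmodule_succ_le_sup {J : Ideal (MvPolynomial σ k)} {l : MvPolynomial σ k}
    {d : ℕ} (hd : homogeneousSubmodule σ k (d + 1) ≤
      J.restrictScalars k ⊔ l • homogeneousSubmodule σ k d) {n : ℕ} (hn : d ≤ n) :
    homogeneousSubmodule σ k (n + 1) ≤
      J.restrictScalars k ⊔ l • homogeneousSubmodule σ k n := by
  obtain ⟨m, rfl⟩ := Nat.exists_eq_add_of_le hn
  have hJ : J.restrictScalars k * homogeneousSubmodule σ k m ≤ J.restrictScalars k :=
    Submodule.mul_le.mpr fun f hf g _ => J.mul_mem_right g hf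
  calc homogeneousSubmodule σ k (d + m + 1)
      = homogeneousSubmodule σ k (d + 1) * homogeneousSubmodule σ k m := by
        rw [homogeneousSubmodule_mul_eq, add_right_comm]
    _ ≤ (J.restrictScalars k ⊔ l • homogeneousSubmodule σ k d) *
          homogeneousSubmodule σ k m := mul_le_mul_left hd _
    _ = J.restrictScalars k * homogeneousSubmodule σ k m ⊔
          l • homogeneousSubmodule σ k (d + m) := by
        rw [Submodule.sup_mul, smul_mul_assoc, homogeneousSubmodule_mul_eq]
    _ ≤ J.restrictScalars k ⊔ l • homogeneousSubmodule σ k (d + m) :=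
        sup_le_sup_right hJ _

variable {I : Ideal (MvPolynomial σ k)} {l : MvPolynomial σ k} {d : ℕ}

theorem homogeneousSubmodule_succ_le_span_sup [Finite σ] {ι : Type*} [Fintype ι]
    {Q : ι → MvPolynomial σ k}
    (hId : ∀ f ∈ I, f.IsHomogeneous d → f = 0) (hl : l.IsHomogeneous 1) (hl0 : l ≠ 0)
    (hreg : ∀ n h, h.IsHomogeneous n → l * h ∈ I → h ∈ I)
    (hQ : ∀ i, (Q i).IsHomogeneous (d + 1)) (hQI : ∀ i, Q i ∈ I) (hind : LinearIndependent k Q)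
    (hdim : finrank k (homogeneousSubmodule σ k (d + 1)) ≤
      Fintype.card ι + finrank k (homogeneousSubmodule σ k d)) :
    homogeneousSubmodule σ k (d + 1) ≤
      Submodule.span k (Set.range Q) ⊔ l • homogeneousSubmodule σ k d := by
  have hfin (n : ℕ) : FiniteDimensional k (homogeneousSubmodule σ k n) :=
    Module.Finite.iff_fg.mpr (homogeneousSubmodule_fg σ k n)
  have hspan : Submodule.span k (Set.range Q) ≤ I.restrictScalars k :=
    Submodule.span_le.mpr (Set.range_subset_iff.mpr hQI)
  have hdisj : Disjoint (Submodule.span k (Set.range Q)) (l • homogeneousSubmodule σ k d) := by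
    rw [Submodule.disjoint_def]
    rintro _ hf ⟨h, hh, rfl⟩
    rw [hId h (hreg d h hh (hspan hf)) hh, map_zero]
  have hle : Submodule.span k (Set.range Q) ⊔ l • homogeneousSubmodule σ k d ≤
      homogeneousSubmodule σ k (d + 1) := by
    refine sup_le (Submodule.span_le.mpr (Set.range_subset_iff.mpr hQ)) ?_
    rintro _ ⟨h, hh, rfl⟩
    simpa [add_comm] using hl.mul hh
  have hfinrank : finrank k (l • homogeneousSubmodule σ k d : Submodule k (MvPolynomial σ k)) =
      finrank k (homogeneousSubmodule σ k d) :=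
    (Submodule.equivMapOfInjective _ (mul_right_injective₀ hl0) _).finrank_eq.symm
  have : FiniteDimensional k (l • homogeneousSubmodule σ k d : Submodule k (MvPolynomial σ k)) :=
    Module.Finite.map _ _
  have : FiniteDimensional k (Submodule.span k (Set.range Q)) :=
    FiniteDimensional.span_of_finite k (Set.finite_range Q)
  refine (Submodule.eq_of_le_of_finrank_le hle ?_).ge
  have hsum := Submodule.finrank_sup_add_finrank_inf_eq (Submodule.span k (Set.range Q))
    (l • homogeneousSubmodule σ k d)
  rw [hdisj.eq_bot, finrank_bot, finrank_span_eq_card hind, hfinrank] at hsum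
  omega

theorem eq_zero_of_isHomogeneous_of_le (hId : ∀ f ∈ I, f.IsHomogeneous d → f = 0)
    (hl : l.IsHomogeneous 1) (hl0 : l ≠ 0) {n : ℕ} (hn : n ≤ d) {f : MvPolynomial σ k}
    (hfI : f ∈ I) (hf : f.IsHomogeneous n) : f = 0 := by
  have hmul : (l ^ (d - n) * f).IsHomogeneous d := by
    simpa [Nat.sub_add_cancel hn] using (hl.pow (d - n)).mul hf
  exact (mul_eq_zero.mp (hId _ (I.mul_mem_left _ hfI) hmul)).resolve_left (pow_ne_zero _ hl0)

theorem eq_span_of_linearIndependent [Finite σ] {ι : Type*} [Fintype ι] {Q : ι → MvPolynomial σ k}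
    (hI : I.IsHomogeneous (homogeneousSubmodule σ k))
    (hId : ∀ f ∈ I, f.IsHomogeneous d → f = 0) (hl : l.IsHomogeneous 1) (hl0 : l ≠ 0)
    (hreg : ∀ n h, h.IsHomogeneous n → l * h ∈ I → h ∈ I)
    (hQ : ∀ i, (Q i).IsHomogeneous (d + 1)) (hQI : ∀ i, Q i ∈ I) (hind : LinearIndependent k Q)
    (hdim : finrank k (homogeneousSubmodule σ k (d + 1)) ≤
      Fintype.card ι + finrank k (homogeneousSubmodule σ k d)) :
    I = Ideal.span (Set.range Q) := by
  set J := Ideal.span (Set.range Q)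
  have hJI : J ≤ I := Ideal.span_le.mpr (Set.range_subset_iff.mpr hQI)
  have hspan : Submodule.span k (Set.range Q) ≤ J.restrictScalars k :=
    Submodule.span_le.mpr Ideal.subset_span
  have hdecomp {n : ℕ} (hn : d ≤ n) :
      homogeneousSubmodule σ k (n + 1) ≤ J.restrictScalars k ⊔ l • homogeneousSubmodule σ k n :=
    homogeneousSubmodule_succ_le_sup ((homogeneousSubmodule_succ_le_span_sup hId hl hl0 hreg hQ
      hQI hind hdim).trans (sup_le_sup_right hspan _)) hn
  have hforms (n : ℕ) : ∀ f ∈ I, f.IsHomogeneous n → f ∈ J := by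
    induction n with
    | zero =>
      intro f hfI hf
      exact eq_zero_of_isHomogeneous_of_le hId hl hl0 d.zero_le hfI hf ▸ J.zero_mem
    | succ n ih =>
      intro f hfI hf
      rcases le_or_gt (n + 1) d with hn | hn
      · exact eq_zero_of_isHomogeneous_of_le hId hl hl0 hn hfI hf ▸ J.zero_mem
      · obtain ⟨q, hq, _, ⟨h, hh, rfl⟩, rfl⟩ :=
          Submodule.mem_sup.mp (hdecomp (Nat.lt_succ_iff.mp hn) hf)
        have hlh : l * h ∈ I := (I.add_mem_iff_right (hJI hq)).mp hfI
        exact J.add_mem hq (J.mul_mem_left l (ih h (hreg n h hh hlh) hh))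
  refine le_antisymm (fun f hf => ?_) hJI
  rw [← sum_homogeneousComponent f]
  exact J.sum_mem fun n _ => hforms n _ (homogeneousComponent_mem_of_mem hI hf n)
    (homogeneousComponent_isHomogeneous n f)

end HomogeneousIdeal

section PointsIdeal

attribute [local instance] MvPolynomial.gradedAlgebra

variable {k : Type*} [Field k] {A : Finset (Plane k)}

theorem mem_pointsIdeal_iff {f : PolyRing k} :
    f ∈ pointsIdeal A ↔ ∀ p ∈ A, ∀ v ∈ p.submodule, eval v f = 0 := by
  simp [pointsIdeal, aeval_eq_eval]

theorem isHomogeneous_pointsIdeal [Infinite k] (A : Finset (Plane k)) :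
    (pointsIdeal A).IsHomogeneous (homogeneousSubmodule (Fin 3) k) :=
  Ideal.IsHomogeneous.iInf₂ fun p _ =>
    isHomogeneous_vanishingIdeal fun c _ hv => p.submodule.smul_mem c hv

theorem mem_pointsIdeal_iff_of_isHomogeneous {f : PolyRing k} {n : ℕ} (hf : f.IsHomogeneous n) :
    f ∈ pointsIdeal A ↔ ∀ p ∈ A, eval p.rep f = 0 := by
  simp only [mem_pointsIdeal_iff, Projectivization.submodule_eq, Submodule.mem_span_singleton,
    forall_exists_index, forall_apply_eq_imp_iff, eval_smul_of_isHomogeneous hf]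
  exact ⟨fun h p hp => by simpa using h p hp 1, fun h p hp c => by rw [h p hp, mul_zero]⟩

theorem mem_pointsIdeal_of_mul_mem {l h : PolyRing k} {n : ℕ} (hl : ∀ p ∈ A, eval p.rep l ≠ 0)
    (hh : h.IsHomogeneous n) (hlh : l * h ∈ pointsIdeal A) : h ∈ pointsIdeal A := by
  rw [mem_pointsIdeal_iff_of_isHomogeneous hh]
  intro p hp
  have hmul := mem_pointsIdeal_iff.mp hlh p hp p.rep (by
    rw [Projectivization.submodule_eq]; exact Submodule.mem_span_singleton_self _)
  rw [map_mul] at hmul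
  exact (mul_eq_zero.mp hmul).resolve_left (hl p hp)

theorem exists_isHomogeneous_one_eval_rep_ne_zero [Infinite k] (A : Finset (Plane k)) :
    ∃ l : PolyRing k, l.IsHomogeneous 1 ∧ ∀ p ∈ A, eval p.rep l ≠ 0 := by
  obtain ⟨φ, hφ⟩ := Module.exists_dual_forall_apply_ne_zero (K := k)
    (fun p : A => (p : Plane k).rep) fun p => p.1.rep_nonzero
  refine ⟨linearForm φ, linearForm_isHomogeneous φ, fun p hp => ?_⟩
  rw [eval_linearForm]
  exact hφ ⟨p, hp⟩

theorem IsGeneric.eq_zero_of_mem (hA : IsGeneric A) {d : ℕ} (hd : (d + 2).choose 2 ≤ A.card)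
    {f : PolyRing k} (hfA : f ∈ pointsIdeal A) (hf : f.IsHomogeneous d) : f = 0 := by
  let φ := (Ideal.Quotient.mkₐ k (pointsIdeal A)).toLinearMap.submoduleMap
    (homogeneousSubmodule (Fin 3) k d)
  have : FiniteDimensional k (homogeneousSubmodule (Fin 3) k d) :=
    Module.Finite.iff_fg.mpr (homogeneousSubmodule_fg (Fin 3) k d)
  have : FiniteDimensional k (quotientDegree (pointsIdeal A) d) := Module.Finite.map _ _
  have hfinrank : finrank k (homogeneousSubmodule (Fin 3) k d) =
      finrank k (quotientDegree (pointsIdeal A) d) := by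
    rw [hA d, min_eq_right hd, finrank_homogeneousSubmodule_fin_three]
  have hinj : Function.Injective φ :=
    (LinearMap.injective_iff_surjective_of_finrank_eq_finrank hfinrank).mpr
      (LinearMap.submoduleMap_surjective _ _)
  have hφf : φ ⟨f, hf⟩ = 0 := Subtype.ext (Ideal.Quotient.eq_zero_iff_mem.mpr hfA)
  exact congrArg Subtype.val ((map_eq_zero_iff φ hinj).mp hφf)

theorem pointsIdeal_eq_span_of_linearIndependent [Infinite k] {d : ℕ} {Q : Fin (d + 2) → PolyRing k}
    (hAd : ∀ f ∈ pointsIdeal A, f.IsHomogeneous d → f = 0) (hQ : ∀ i, (Q i).IsHomogeneous (d + 1))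
    (hQA : ∀ i, Q i ∈ pointsIdeal A) (hind : LinearIndependent k Q) :
    pointsIdeal A = Ideal.span (Set.range Q) := by
  obtain ⟨l, hl, hlA⟩ := exists_isHomogeneous_one_eval_rep_ne_zero A
  have hl0 : l ≠ 0 := by
    rintro rfl
    have hX : (X 0 ^ d : PolyRing k).IsHomogeneous d := isHomogeneous_X_pow 0 d
    exact pow_ne_zero d (X_ne_zero 0)
      (hAd _ (mem_pointsIdeal_of_mul_mem hlA hX (by simp)) hX)
  refine eq_span_of_linearIndependent (isHomogeneous_pointsIdeal A) hAd hl hl0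
    (fun n h hh => mem_pointsIdeal_of_mul_mem hlA hh) hQ hQA hind ?_
  rw [finrank_homogeneousSubmodule_fin_three, finrank_homogeneousSubmodule_fin_three,
    Fintype.card_fin, Nat.choose_succ_succ' (d + 2) 1, Nat.choose_one_right]

end PointsIdeal

section Lines

theorem disjoint_sup_inf_sup_left {α : Type*} [Lattice α] [IsModularLattice α] [OrderBot α]
    {a b e m : α} (hb : Disjoint b (a ⊔ e)) (ha : Disjoint a m) :
    Disjoint ((a ⊔ b) ⊓ m) (a ⊔ e) := by
  have hab : (a ⊔ b) ⊓ (a ⊔ e) = a := by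
    rw [sup_inf_assoc_of_le b le_sup_left, hb.eq_bot, sup_bot_eq]
  rwa [disjoint_iff, inf_right_comm, hab, ← disjoint_iff]

section Projectivization

variable {K V : Type*} [DivisionRing K] [AddCommGroup V] [Module K V] {p q r : ℙ K V}

theorem isAtom_submodule (p : ℙ K V) : IsAtom p.submodule :=
  Submodule.isAtom_iff_finrank_eq_one.mpr p.finrank_submodule

theorem finrank_submodule_sup_le (p q : ℙ K V) :
    finrank K (p.submodule ⊔ q.submodule : Submodule K V) ≤ 2 := by
  have hsum := Submodule.finrank_sup_add_finrank_inf_eq p.submodule q.submodule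
  rw [p.finrank_submodule, q.finrank_submodule] at hsum
  omega

theorem finrank_submodule_sup (hpq : p ≠ q) :
    finrank K (p.submodule ⊔ q.submodule : Submodule K V) = 2 := by
  have hdisj := (isAtom_submodule p).disjoint_of_ne (isAtom_submodule q)
    (Projectivization.submodule_injective.ne hpq)
  have hsum := Submodule.finrank_sup_add_finrank_inf_eq p.submodule q.submodule
  rwa [hdisj.eq_bot, finrank_bot, p.finrank_submodule, q.finrank_submodule] at hsum

theorem disjoint_submodule_of_not_isCollinear
    (h : ¬ Projectivization.IsCollinear {p, q, r}) :
    Disjoint p.submodule (q.submodule ⊔ r.submodule) := by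
  refine ((isAtom_submodule p).not_le_iff_disjoint).mp fun hp => h ?_
  set M := q.submodule ⊔ r.submodule
  have hM : M.projectivization.submodule = M := OrderIso.apply_symm_apply _ M
  refine ⟨M.projectivization, ?_, ?_, ?_⟩
  · rw [hM]
    infer_instance
  · rw [hM]
    exact finrank_submodule_sup_le q r
  · rintro x (rfl | rfl | rfl) <;>
      rw [SetLike.mem_coe, Submodule.mem_projectivization_iff_submodule_le]
    exacts [hp, le_sup_left, le_sup_right]

theorem notMem_submodule_sup {s t : ℙ K V} (hqpt : ¬ Projectivization.IsCollinear {q, p, t})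
    (hprs : ¬ Projectivization.IsCollinear {p, r, s}) {x : V} (hx : x ≠ 0)
    (hxpq : x ∈ p.submodule ⊔ q.submodule) (hxrs : x ∈ r.submodule ⊔ s.submodule) :
    x ∉ p.submodule ⊔ t.submodule := fun hxpt =>
  hx (Submodule.disjoint_def.mp
    (disjoint_sup_inf_sup_left (disjoint_submodule_of_not_isCollinear hqpt)
      (disjoint_submodule_of_not_isCollinear hprs)) x ⟨hxpq, hxrs⟩ hxpt)

end Projectivization

variable {k : Type*} [Field k] {p q r s : Plane k} {l : PolyRing k}

theorem exists_ne_zero_mem_inf_of_ne (hpq : p ≠ q) (hrs : r ≠ s) :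
    ∃ x ≠ 0, x ∈ p.submodule ⊔ q.submodule ∧ x ∈ r.submodule ⊔ s.submodule := by
  have hnot : ¬ Disjoint (p.submodule ⊔ q.submodule) (r.submodule ⊔ s.submodule) := fun h => by
    have hle := Submodule.finrank_add_finrank_le_of_disjoint h
    rw [finrank_submodule_sup hpq, finrank_submodule_sup hrs, finrank_fin_fun] at hle
    omega
  rw [disjoint_iff, ← ne_eq, Submodule.ne_bot_iff] at hnot
  obtain ⟨x, hx, hx0⟩ := hnot
  exact ⟨x, hx0, hx⟩

theorem exists_isLineEquation (p q : Plane k) : ∃ l : PolyRing k, IsLineEquation l p q := by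
  have hlt : p.submodule ⊔ q.submodule < ⊤ := by
    refine lt_top_iff_ne_top.mpr fun h => ?_
    have hle := finrank_submodule_sup_le p q
    rw [h, finrank_top, finrank_fin_fun] at hle
    omega
  obtain ⟨φ, hφ, hker⟩ := Submodule.exists_le_ker_of_lt_top _ hlt
  refine ⟨linearForm φ, ?_, linearForm_isHomogeneous φ, fun v hv => ?_, fun v hv => ?_⟩
  · intro h
    exact hφ (LinearMap.ext fun v => by rw [← eval_linearForm, h, map_zero, LinearMap.zero_apply])
  · exact (eval_linearForm φ v).trans (hker (le_sup_left (a := p.submodule) hv))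
  · exact (eval_linearForm φ v).trans (hker (le_sup_right (b := q.submodule) hv))

theorem IsLineEquation.eval_eq_zero_iff (hl : IsLineEquation l p q) (hpq : p ≠ q)
    {v : Fin 3 → k} : eval v l = 0 ↔ v ∈ p.submodule ⊔ q.submodule := by
  obtain ⟨hl0, hl1, hp, hq⟩ := hl
  obtain ⟨φ, rfl⟩ := exists_linearForm_eq hl1
  have hφ : φ ≠ 0 := by
    rintro rfl
    simp [linearForm] at hl0
  have hker : p.submodule ⊔ q.submodule = LinearMap.ker φ := by
    refine Submodule.eq_of_le_of_finrank_eq (sup_le ?_ ?_) ?_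
    · exact fun v hv => (eval_linearForm φ v).symm.trans (hp v hv)
    · exact fun v hv => (eval_linearForm φ v).symm.trans (hq v hv)
    · have hdim := Dual.finrank_ker_add_one_of_ne_zero hφ
      rw [finrank_fin_fun] at hdim
      rw [finrank_submodule_sup hpq]
      omega
  rw [hker, LinearMap.mem_ker, eval_linearForm]

end Lines

section SixPoints

variable {k : Type*} [Field k] {p : Fin 6 → Plane k} {L : Fin 6 → Fin 6 → PolyRing k}

/-- The products of lines `Q₁, …, Q₄` of the theorem, with the points numbered from `0`. -/
noncomputable def lineCubics (L : Fin 6 → Fin 6 → PolyRing k) : Fin 4 → PolyRing k :=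
  ![L 0 1 * L 2 3 * L 4 5, L 0 1 * L 2 4 * L 3 5, L 0 4 * L 1 5 * L 2 3, L 0 2 * L 1 5 * L 3 4]

theorem range_lineCubics (L : Fin 6 → Fin 6 → PolyRing k) :
    Set.range (lineCubics L) = {L 0 1 * L 2 3 * L 4 5, L 0 1 * L 2 4 * L 3 5,
      L 0 4 * L 1 5 * L 2 3, L 0 2 * L 1 5 * L 3 4} := by
  simp only [lineCubics, Matrix.range_cons, Matrix.range_empty, Set.union_empty,
    Set.singleton_union]

theorem lineCubics_isHomogeneous (hL : ∀ i j, i < j → IsLineEquation (L i j) (p i) (p j))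
    (i : Fin 4) : (lineCubics L i).IsHomogeneous 3 := by
  have hprod {a b c d e f : Fin 6} (hab : a < b) (hcd : c < d) (hef : e < f) :
      (L a b * L c d * L e f).IsHomogeneous 3 :=
    ((hL a b hab).2.1.mul (hL c d hcd).2.1).mul (hL e f hef).2.1
  fin_cases i <;> exact hprod (by decide) (by decide) (by decide)

theorem isProductOfLinearForms_lineCubics
    (hL : ∀ i j, i < j → IsLineEquation (L i j) (p i) (p j)) (i : Fin 4) :
    IsProductOfLinearForms (lineCubics L i) := by
  have hprod {a b c d e f : Fin 6} (hab : a < b) (hcd : c < d) (hef : e < f) :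
      IsProductOfLinearForms (L a b * L c d * L e f) := by
    refine ⟨{L a b, L c d, L e f}, ?_, by simp [mul_assoc]⟩
    simp only [Multiset.insert_eq_cons, Multiset.mem_cons, Multiset.mem_singleton]
    rintro l (rfl | rfl | rfl)
    exacts [(hL _ _ hab).2.1, (hL _ _ hcd).2.1, (hL _ _ hef).2.1]
  fin_cases i <;> exact hprod (by decide) (by decide) (by decide)

theorem lineCubics_mem_pointsIdeal {A : Finset (Plane k)} (hpA : ∀ q ∈ A, ∃ i, p i = q)
    (hL : ∀ i j, i < j → IsLineEquation (L i j) (p i) (p j)) (i : Fin 4) :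
    lineCubics L i ∈ pointsIdeal A := by
  have hprod {a b c d e f : Fin 6} (hab : a < b) (hcd : c < d) (hef : e < f)
      (hcover : ∀ i, i = a ∨ i = b ∨ i = c ∨ i = d ∨ i = e ∨ i = f) :
      L a b * L c d * L e f ∈ pointsIdeal A := by
    rw [mem_pointsIdeal_iff]
    intro q hq v hv
    obtain ⟨i, rfl⟩ := hpA q hq
    simp only [map_mul, mul_eq_zero, or_assoc]
    rcases hcover i with rfl | rfl | rfl | rfl | rfl | rfl
    · exact .inl ((hL _ _ hab).2.2.1 v hv)
    · exact .inl ((hL _ _ hab).2.2.2 v hv)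
    · exact .inr (.inl ((hL _ _ hcd).2.2.1 v hv))
    · exact .inr (.inl ((hL _ _ hcd).2.2.2 v hv))
    · exact .inr (.inr ((hL _ _ hef).2.2.1 v hv))
    · exact .inr (.inr ((hL _ _ hef).2.2.2 v hv))
  fin_cases i <;> exact hprod (by decide) (by decide) (by decide) (by decide)

theorem exists_eval_eq_zero_and_eval_ne_zero {ι : Type*} [LinearOrder ι] {p : ι → Plane k}
    {L : ι → ι → PolyRing k} (hinj : Function.Injective p)
    (hp : ∀ a b c, a ≠ b → a ≠ c → b ≠ c → ¬ Projectivization.IsCollinear {p a, p b, p c})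
    (hL : ∀ i j, i < j → IsLineEquation (L i j) (p i) (p j)) {a b c d : ι}
    (hab : a < b) (hcd : c < d) (hac : a ≠ c) (had : a ≠ d) (hbc : b ≠ c) (hbd : b ≠ d) :
    ∃ x, eval x (L a b) = 0 ∧ eval x (L c d) = 0 ∧
      ∀ i j, i < j → s(i, j) ≠ s(a, b) → s(i, j) ≠ s(c, d) →
        (i ∈ [a, b, c, d] ∨ j ∈ [a, b, c, d]) → eval x (L i j) ≠ 0 := by
  obtain ⟨x, hx0, hxab, hxcd⟩ := exists_ne_zero_mem_inf_of_ne (hinj.ne hab.ne) (hinj.ne hcd.ne)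
  have hzero {i j : ι} (hij : i < j) :
      eval x (L i j) = 0 ↔ x ∈ (p i).submodule ⊔ (p j).submodule :=
    (hL i j hij).eval_eq_zero_iff (hinj.ne hij.ne)
  have hnotMem {i j m n e : ι} (hxij : x ∈ (p i).submodule ⊔ (p j).submodule)
      (hxmn : x ∈ (p m).submodule ⊔ (p n).submodule) (hij : i ≠ j) (him : i ≠ m) (hin : i ≠ n)
      (hmn : m ≠ n) (hie : i ≠ e) (hje : j ≠ e) : x ∉ (p i).submodule ⊔ (p e).submodule :=
    notMem_submodule_sup (hp j i e hij.symm hje hie) (hp i m n him hin hmn) hx0 hxij hxmn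
  have hxba := sup_comm (p a).submodule (p b).submodule ▸ hxab
  have hxdc := sup_comm (p c).submodule (p d).submodule ▸ hxcd
  have hnot {i j : ι} (hij : i ≠ j) (hijab : s(i, j) ≠ s(a, b)) (hijcd : s(i, j) ≠ s(c, d))
      (hi : i ∈ [a, b, c, d]) : x ∉ (p i).submodule ⊔ (p j).submodule := by
    simp only [ne_eq, Sym2.eq_iff, not_or, not_and] at hijab hijcd
    simp only [List.mem_cons, List.not_mem_nil, or_false] at hi
    rcases hi with rfl | rfl | rfl | rfl
    · exact hnotMem hxab hxcd hab.ne hac had hcd.ne hij fun h => hijab.1 rfl h.symm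
    · exact hnotMem hxba hxcd hab.ne' hbc hbd hcd.ne hij fun h => hijab.2 rfl h.symm
    · exact hnotMem hxcd hxab hcd.ne hac.symm hbc.symm hab.ne hij fun h => hijcd.1 rfl h.symm
    · exact hnotMem hxdc hxab hcd.ne' had.symm hbd.symm hab.ne hij fun h => hijcd.2 rfl h.symm
  refine ⟨x, (hzero hab).mpr hxab, (hzero hcd).mpr hxcd, fun i j hij hijab hijcd hmeet => ?_⟩
  rw [ne_eq, hzero hij]
  rcases hmeet with hi | hj
  · exact hnot hij.ne hijab hijcd hi
  · rw [sup_comm]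
    exact hnot hij.ne' (Sym2.eq_swap (a := j) ▸ hijab) (Sym2.eq_swap (a := j) ▸ hijcd) hj

theorem linearIndependent_lineCubics (hinj : Function.Injective p)
    (hp : ∀ a b c, a ≠ b → a ≠ c → b ≠ c → ¬ Projectivization.IsCollinear {p a, p b, p c})
    (hL : ∀ i j, i < j → IsLineEquation (L i j) (p i) (p j)) :
    LinearIndependent k (lineCubics L) := by
  have hmeet {a b c d : Fin 6} (hab : a < b) (hcd : c < d) (h : [a, b, c, d].Nodup) := by
    simp only [List.nodup_cons, List.mem_cons, List.not_mem_nil, or_false, not_or] at h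
    exact exists_eval_eq_zero_and_eval_ne_zero hinj hp hL hab hcd h.1.2.1 h.1.2.2 h.2.1.1 h.2.1.2
  obtain ⟨x₁, h₁₅, h₂₄, hx₁⟩ := hmeet (show (1 : Fin 6) < 5 by decide)
    (show (2 : Fin 6) < 4 by decide) (by decide)
  obtain ⟨x₂, h₁₅', h₂₃, hx₂⟩ := hmeet (show (1 : Fin 6) < 5 by decide)
    (show (2 : Fin 6) < 3 by decide) (by decide)
  obtain ⟨x₃, h₀₁, h₃₄, hx₃⟩ := hmeet (show (0 : Fin 6) < 1 by decide)
    (show (3 : Fin 6) < 4 by decide) (by decide)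
  obtain ⟨x₄, h₀₁', h₂₃', hx₄⟩ := hmeet (show (0 : Fin 6) < 1 by decide)
    (show (2 : Fin 6) < 3 by decide) (by decide)
  refine linearIndependent_of_eval ![x₁, x₂, x₃, x₄] (fun i => ?_) fun i j hij => ?_
  · fin_cases i
    · simp [lineCubics, hx₁ 0 1, hx₁ 2 3, hx₁ 4 5]
    · simp [lineCubics, hx₂ 0 1, hx₂ 2 4, hx₂ 3 5]
    · simp [lineCubics, hx₃ 0 4, hx₃ 1 5, hx₃ 2 3]
    · simp [lineCubics, hx₄ 0 2, hx₄ 1 5, hx₄ 3 4]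
  · fin_cases i <;> fin_cases j <;> first
      | exact absurd rfl hij
      | simp [lineCubics, h₁₅, h₂₄, h₁₅', h₂₃, h₀₁, h₃₄, h₀₁', h₂₃']

theorem pointsIdeal_eq_span_lineCubics [Infinite k] {A : Finset (Plane k)} (hcard : A.card = 6)
    (hgeneric : IsGeneric A) (hlinear : IsLinearlyGeneral A) (hinj : Function.Injective p)
    (hpA : Set.range p = (A : Set _))
    (hL : ∀ i j, i < j → IsLineEquation (L i j) (p i) (p j)) :
    pointsIdeal A = Ideal.span (Set.range (lineCubics L)) := by
  have hmem (i : Fin 6) : p i ∈ A := Finset.mem_coe.mp (hpA ▸ Set.mem_range_self i)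
  have hrange (q : Plane k) (hq : q ∈ A) : ∃ i, p i = q := by
    rwa [← Finset.mem_coe, ← hpA] at hq
  refine pointsIdeal_eq_span_of_linearIndependent (d := 2)
    (fun f => hgeneric.eq_zero_of_mem (by rw [hcard]; rfl)) (lineCubics_isHomogeneous hL)
    (lineCubics_mem_pointsIdeal hrange hL) (linearIndependent_lineCubics hinj ?_ hL)
  exact fun a b c hab hac hbc => hlinear _ (hmem a) _ (hmem b) _ (hmem c)
    (hinj.ne hab) (hinj.ne hac) (hinj.ne hbc)

end SixPoints

end PlanePoints

/-- The points are labelled `p 0, …, p 5` in an arbitrary way, and `L i j` is any equation of the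
line joining `p i` to `p j`. -/
theorem mainTheorem6 {k : Type*} [Field k] [Infinite k]
    (A : Finset (PlanePoints.Plane k)) (hcard : A.card = 6)
    (hgeneric : PlanePoints.IsGeneric A) (hlinear : PlanePoints.IsLinearlyGeneral A) :
    (∀ p : Fin 6 → PlanePoints.Plane k, Function.Injective p → Set.range p = (A : Set _) →
      ∀ L : Fin 6 → Fin 6 → PlanePoints.PolyRing k,
        (∀ i j, i < j → PlanePoints.IsLineEquation (L i j) (p i) (p j)) →
        PlanePoints.pointsIdeal A = Ideal.span
          {L 0 1 * L 2 3 * L 4 5,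
           L 0 1 * L 2 4 * L 3 5,
           L 0 4 * L 1 5 * L 2 3,
           L 0 2 * L 1 5 * L 3 4}) ∧
    PlanePoints.IsPLGenerated (PlanePoints.pointsIdeal A) := by
  refine ⟨fun p hinj hpA L hL => ?_, ?_⟩
  · rw [← PlanePoints.range_lineCubics]
    exact PlanePoints.pointsIdeal_eq_span_lineCubics hcard hgeneric hlinear hinj hpA hL
  · let e := (A.equivFinOfCardEq hcard).symm
    have hrange : Set.range (fun i => (e i : PlanePoints.Plane k)) = A := by
      rw [Set.range_comp' Subtype.val e, e.range_eq_univ, Set.image_univ, Subtype.range_coe]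
    choose L hL using fun i j => PlanePoints.exists_isLineEquation (e i).1 (e j).1
    exact ⟨Set.range (PlanePoints.lineCubics L),
      Set.forall_mem_range.mpr
        (PlanePoints.isProductOfLinearForms_lineCubics fun i j _ => hL i j),
      PlanePoints.pointsIdeal_eq_span_lineCubics hcard hgeneric hlinear
        (Subtype.val_injective.comp e.injective) hrange fun i j _ => hL i j⟩
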